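/- Let $\mathcal F_{\lambda,n}$ denote the family of all subsets of $\{1,\dots,n\}$ of size at most $\lambda n$. A sequence of integers $(a_1,\dots,a_n)$ is called sum-distinct if $\sum_{i\in A_1}a_i\ne\sum_{i\in A_2}a_i$ for all distinct $A_1,A_2\subseteq\{1,\dots,n\}$, and $\mathcal F_{\lambda,n}$-sum distinct if this holds for all distinct $A_1,A_2\in\mathcal F_{\lambda,n}$. Let $(\overline c_1,\dots,\overline c_{67})$ be any sum-distinct sequence of integers (for instance Lunnon's), and for $m\ge 67$ and $1\le i\le m$ put $$c_{i,m}=\begin{cases}2^{i-1}&\text{if } i\le m-67,\\ 2^{m-67}\,\overline c_{i-(m-67)}&\text{otherwise.}\end{cases}$$ For an integer $n\ge 69$ put $n'=\lfloor (n-69)/2\rfloor$ and let $\Sigma=(a_1,\dots,a_n)$ be the sequence of integers $$a_i=\begin{cases}\displaystyle\sum_{\lceil n'/2\rceil-1\,\le\, j\,<\,(n-69)/2-1} 2^{2j}&\text{if } i=n,\\[2ex] \displaystyle\sum_{0\le j<n'/2-1}2^{2j}&\text{if } i=n-1,\\[2ex] c_{i,n-2}&\text{if } 1\le i\le n-2,\end{cases}$$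 where the sums are over nonnegative integers $j$. Then for every real $\lambda<1/8$ there is an $N\ge 69$, depending only on $\lambda$, such that for all $n\ge N$ and for every choice of the sum-distinct sequence $(\overline c_1,\dots,\overline c_{67})$, the sequence $\Sigma$ is $\mathcal F_{\lambda,n}$-sum distinct. -/

import Mathlib

namespace SumDistinct

/-- The family `F_{lam,n}` of all subsets of `{1, …, n}` of size at most `lam * n`. -/
def smallSubsets (lam : ℝ) (n : ℕ) : Set (Finset ℕ) :=
  {A | A ⊆ Finset.Icc 1 n ∧ (A.card : ℝ) ≤ lam * n}

/-- `S(A) = ∑_{i ∈ A} a_i`. -/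
def subsetSum (a : ℕ → ℤ) (A : Finset ℕ) : ℤ := ∑ i ∈ A, a i

/-- The sequence `(a_1, …, a_n)` is `F_{lam,n}`-sum distinct: distinct members of `F_{lam,n}` have
distinct sums. Only the values `a 1, …, a n` matter. -/
def IsSumDistinctUpTo (lam : ℝ) (n : ℕ) (a : ℕ → ℤ) : Prop :=
  ∀ A₁ ∈ smallSubsets lam n, ∀ A₂ ∈ smallSubsets lam n, A₁ ≠ A₂ → subsetSum a A₁ ≠ subsetSum a A₂

/-- The sequence `(a_1, …, a_n)` is sum-distinct: all its `2 ^ n` subset sums are distinct. -/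
def IsSumDistinct (n : ℕ) (a : ℕ → ℤ) : Prop :=
  ∀ A₁ ⊆ Finset.Icc 1 n, ∀ A₂ ⊆ Finset.Icc 1 n, A₁ ≠ A₂ → subsetSum a A₁ ≠ subsetSum a A₂

/-- Lunnon's extension of a 67-term sequence `cbar_1, …, cbar_67` to a sequence
`c_{1,m}, …, c_{m,m}`, for `m ≥ 67`:
`c_{i,m} = 2 ^ (i - 1)` for `i ≤ m - 67`, and `c_{i,m} = 2 ^ (m - 67) * cbar_{i - (m - 67)}`
otherwise. -/
def lunnonSeq (cbar : ℕ → ℤ) (m i : ℕ) : ℤ :=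
  if i ≤ m - 67 then 2 ^ (i - 1) else 2 ^ (m - 67) * cbar (i - (m - 67))

/-- `n' = ⌊(n - 69) / 2⌋`. -/
def halfIndex (n : ℕ) : ℤ := ⌊((n : ℚ) - 69) / 2⌋

/-- `∑ 2 ^ (2 j)` over the integers `0 ≤ j < n' / 2 - 1`
(such `j` are `< n`, so the range loses nothing). -/
def lowerSum (n : ℕ) : ℤ :=
  ∑ j ∈ (Finset.range n).filter (fun j : ℕ => (j : ℚ) < (halfIndex n : ℚ) / 2 - 1), 2 ^ (2 * j)

/-- `∑ 2 ^ (2 j)` over the integers `⌈n' / 2⌉ - 1 ≤ j < (n - 69) / 2 - 1`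
(for `j ≥ 0`, such `j` are `< n`, so the range loses nothing). -/
def upperSum (n : ℕ) : ℤ :=
  ∑ j ∈ (Finset.range n).filter (fun j : ℕ =>
    ⌈(halfIndex n : ℚ) / 2⌉ - 1 ≤ (j : ℤ) ∧ (j : ℚ) < ((n : ℚ) - 69) / 2 - 1), 2 ^ (2 * j)

/-- The sequence `c_{1,n-2}, …, c_{n-2,n-2}` with the two sums appended. -/
def twoInsertions (cbar : ℕ → ℤ) (n i : ℕ) : ℤ :=
  if i = n then upperSum n
  else if i = n - 1 then lowerSum n
  else lunnonSeq cbar (n - 2) i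

end SumDistinct

/-!
Two subsets `A₁, A₂` with equal sums give coefficients `δ i = 1_{A₁}(i) - 1_{A₂}(i)`, each in
`{-1, 0, 1}`, with `∑ δ i * a i = 0`. Put `M = n - 69`. The terms built from `cbar` are multiples
of `2 ^ M`, so modulo `2 ^ M` the relation says that `δ n * upperSum n + δ (n - 1) * lowerSum n` is
minus the signed binary number with digits `δ 1, …, δ M`.

If `δ n = δ (n - 1) = 0`, the signed digits vanish one after the other from the lowest upwards, and
what is left is a relation among the `cbar i`, which is trivial because `cbar` is sum-distinct.

Otherwise the integer `δ n * upperSum n + δ (n - 1) * lowerSum n` is a sum `∑ e j * 4 ^ j` with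
`e j ∈ {-1, 0, 1}`, in which every `j` in the range of `upperSum` (if `δ n ≠ 0`) or in the range of
`lowerSum` (if `δ (n - 1) ≠ 0`) contributes a nonzero digit. The two ranges are disjoint and each
has about `n / 4` elements. Such a number is in non-adjacent form, so no signed binary
representation has fewer nonzero digits, even modulo `2 ^ M`
(`sum_abs_le_of_four_pow_dvd`). Hence `n / 4 - O(1) ≤ |A₁| + |A₂| ≤ 2 λ n`,
which is false for large `n` as `λ < 1 / 8`.
-/

namespace SumDistinct

/-! ### Signed binary representations -/

/-- A signed binary number with `M` digits is divisible by `2 ^ M` only if all digits vanish. -/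
theorem eq_zero_of_two_pow_dvd (M : ℕ) (d : ℕ → ℤ) (hd : ∀ i, |d i| ≤ 1)
    (h : (2 : ℤ) ^ M ∣ ∑ i ∈ Finset.range M, d i * 2 ^ i) : ∀ i < M, d i = 0 := by
  induction M generalizing d with
  | zero => simp
  | succ M ih =>
    have hs : ∑ i ∈ Finset.range (M + 1), d i * 2 ^ i
        = 2 * ∑ i ∈ Finset.range M, d (i + 1) * 2 ^ i + d 0 := by
      rw [Finset.sum_range_succ', Finset.mul_sum]
      simp only [pow_zero, mul_one, pow_succ]
      congr 1
      exact Finset.sum_congr rfl fun i _ => by ring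
    rw [hs] at h
    obtain ⟨q, hq⟩ := h
    have h0 : d 0 = 0 := by
      have := abs_le.mp (hd 0)
      rw [pow_succ'] at hq
      have : (2 : ℤ) ∣ d 0 :=
        ⟨2 ^ M * q - ∑ i ∈ Finset.range M, d (i + 1) * 2 ^ i, by linarith⟩
      omega
    have := ih (fun i => d (i + 1)) (fun i => hd _) ⟨q, by
      rw [pow_succ'] at hq
      linarith⟩
    intro i hi
    cases i with
    | zero => exact h0
    | succ i => exact this i (by omega)

/-- Minimality of the non-adjacent form `∑ e j * 4 ^ j`, modulo `4 ^ k`: a signed binary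
representation has at least as many nonzero digits. The carry `c` is what the induction,
which removes two binary digits at a time from the low end, passes on. -/
theorem sum_abs_le_of_four_pow_dvd (k : ℕ) (d e : ℕ → ℤ) (c : ℤ) (hd : ∀ i, |d i| ≤ 1)
    (he : ∀ j, |e j| ≤ 1) (hc : |c| ≤ 1)
    (h : (4 : ℤ) ^ k ∣ c + ∑ i ∈ Finset.range (2 * k), d i * 2 ^ i
      - ∑ j ∈ Finset.range k, e j * 4 ^ j) :
    ∑ j ∈ Finset.range k, |e j| ≤ |c| + ∑ i ∈ Finset.range (2 * k), |d i| := by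
  induction k generalizing d e c with
  | zero => simp
  | succ k ih =>
    have hs : ∑ i ∈ Finset.range (2 * (k + 1)), d i * 2 ^ i
        = 4 * ∑ i ∈ Finset.range (2 * k), d (i + 2) * 2 ^ i + 2 * d 1 + d 0 := by
      rw [show 2 * (k + 1) = 2 * k + 1 + 1 by ring, Finset.sum_range_succ',
        Finset.sum_range_succ', Finset.mul_sum]
      have : ∑ i ∈ Finset.range (2 * k), d (i + 1 + 1) * 2 ^ (i + 1 + 1)
          = ∑ i ∈ Finset.range (2 * k), 4 * (d (i + 2) * 2 ^ i) :=
        Finset.sum_congr rfl fun i _ => by ring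
      rw [this]
      ring
    have ht : ∑ j ∈ Finset.range (k + 1), e j * 4 ^ j
        = 4 * ∑ j ∈ Finset.range k, e (j + 1) * 4 ^ j + e 0 := by
      rw [Finset.sum_range_succ', Finset.mul_sum]
      have : ∑ j ∈ Finset.range k, e (j + 1) * 4 ^ (j + 1)
          = ∑ j ∈ Finset.range k, 4 * (e (j + 1) * 4 ^ j) :=
        Finset.sum_congr rfl fun i _ => by ring
      rw [this]
      ring
    rw [hs, ht] at h
    obtain ⟨q, hq⟩ := h
    rw [pow_succ'] at hq
    obtain ⟨c', hc'⟩ : (4 : ℤ) ∣ c + 2 * d 1 + d 0 - e 0 :=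
      ⟨4 ^ k * q - ∑ i ∈ Finset.range (2 * k), d (i + 2) * 2 ^ i
        + ∑ j ∈ Finset.range k, e (j + 1) * 4 ^ j, by linarith⟩
    have h0 := hd 0
    have h1 := hd 1
    have h2 := he 0
    have step := ih (fun i => d (i + 2)) (fun j => e (j + 1)) c' (fun i => hd _) (fun j => he _)
      (by grind) ⟨q, by linarith⟩
    -- A carry out of the two lowest digits is paid for by a surplus of nonzero digits there.
    have key : |e 0| + |c'| ≤ |c| + |d 0| + |d 1| := by grind
    rw [show 2 * (k + 1) = 2 * k + 1 + 1 by ring, Finset.sum_range_succ',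
      Finset.sum_range_succ', Finset.sum_range_succ']
    simp only [zero_add, add_assoc, Nat.reduceAdd] at step ⊢
    linarith

/-! ### Sum-distinctness in terms of coefficients -/

/-- A sum-distinct sequence satisfies no nontrivial relation with coefficients `-1, 0, 1`. -/
theorem IsSumDistinct.eq_zero {n : ℕ} {a : ℕ → ℤ} (ha : IsSumDistinct n a) (d : ℕ → ℤ)
    (hd : ∀ i, |d i| ≤ 1) (h : ∑ i ∈ Finset.Icc 1 n, d i * a i = 0) :
    ∀ i ∈ Finset.Icc 1 n, d i = 0 := by
  by_contra! hne
  obtain ⟨i, hi, hdi⟩ := hne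
  refine ha ((Finset.Icc 1 n).filter (d · = 1)) (Finset.filter_subset _ _)
    ((Finset.Icc 1 n).filter (d · = -1)) (Finset.filter_subset _ _) ?_ ?_
  · intro heq
    have := congrArg (i ∈ ·) heq
    have := abs_le.mp (hd i)
    simp only [Finset.mem_filter, hi, true_and, eq_iff_iff] at *
    omega
  · unfold subsetSum
    rw [Finset.sum_filter, Finset.sum_filter, ← sub_eq_zero, ← Finset.sum_sub_distrib]
    refine Eq.trans (Finset.sum_congr rfl fun j _ => ?_) h
    have := abs_le.mp (hd j)
    have : d j = -1 ∨ d j = 0 ∨ d j = 1 := by omega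
    rcases this with h | h | h <;> simp [h]

/-- The coefficient of the `i`-th term in the difference of the sums over `A` and `B`. -/
def signDiff (A B : Finset ℕ) (i : ℕ) : ℤ := (if i ∈ A then 1 else 0) - (if i ∈ B then 1 else 0)

theorem abs_signDiff_le_one (A B : Finset ℕ) (i : ℕ) : |signDiff A B i| ≤ 1 := by
  unfold signDiff
  split_ifs <;> simp

theorem sum_signDiff_mul {n : ℕ} {A B : Finset ℕ} (hA : A ⊆ Finset.Icc 1 n)
    (hB : B ⊆ Finset.Icc 1 n) (a : ℕ → ℤ) :
    ∑ i ∈ Finset.Icc 1 n, signDiff A B i * a i = subsetSum a A - subsetSum a B := by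
  simp only [signDiff, subsetSum, sub_mul, ite_mul, one_mul, zero_mul, Finset.sum_sub_distrib,
    Finset.sum_ite_mem, Finset.inter_eq_right.mpr hA, Finset.inter_eq_right.mpr hB]

theorem sum_abs_signDiff_le {n : ℕ} {A B : Finset ℕ} (hA : A ⊆ Finset.Icc 1 n)
    (hB : B ⊆ Finset.Icc 1 n) :
    ∑ i ∈ Finset.Icc 1 n, |signDiff A B i| ≤ A.card + B.card := by
  calc ∑ i ∈ Finset.Icc 1 n, |signDiff A B i|
      ≤ ∑ i ∈ Finset.Icc 1 n, ((if i ∈ A then 1 else 0) + (if i ∈ B then 1 else 0)) := by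
        refine Finset.sum_le_sum fun i _ => ?_
        unfold signDiff
        split_ifs <;> simp
    _ = A.card + B.card := by
        simp [Finset.sum_add_distrib, Finset.sum_ite_mem, Finset.inter_eq_right.mpr hA,
          Finset.inter_eq_right.mpr hB]

theorem eq_of_signDiff_eq_zero {n : ℕ} {A B : Finset ℕ} (hA : A ⊆ Finset.Icc 1 n)
    (hB : B ⊆ Finset.Icc 1 n) (h : ∀ i ∈ Finset.Icc 1 n, signDiff A B i = 0) : A = B := by
  ext i
  by_cases hi : i ∈ Finset.Icc 1 n
  · have := h i hi
    unfold signDiff at this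
    split_ifs at this <;> simp_all
  · exact iff_of_false (fun h => hi (hA h)) (fun h => hi (hB h))

theorem sum_Icc_one_eq_sum_range {R : Type*} [AddCommMonoid R] (f : ℕ → R) (n : ℕ) :
    ∑ i ∈ Finset.Icc 1 n, f i = ∑ i ∈ Finset.range n, f (i + 1) := by
  induction n with
  | zero => simp
  | succ n ih => rw [Finset.sum_Icc_succ_top (by omega), ih, Finset.sum_range_succ]

/-! ### The two inserted terms -/

theorem halfIndex_add (M : ℕ) : halfIndex (M + 69) = ((M / 2 : ℕ) : ℤ) := by
  unfold halfIndex
  push_cast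
  rw [add_sub_cancel_right]
  exact_mod_cast Rat.floor_natCast_div_natCast M 2

/-- With `M = n - 69`, the sum `lowerSum n` runs over `2 * j + 2 < ⌊M / 2⌋`. -/
theorem lowerSum_add (M : ℕ) :
    lowerSum (M + 69) = ∑ j ∈ Finset.range (M / 2), if 2 * j + 2 < M / 2 then 4 ^ j else 0 := by
  unfold lowerSum
  rw [← Finset.sum_filter, halfIndex_add]
  refine Finset.sum_congr ?_ fun j _ => by rw [pow_mul]; norm_num
  ext j
  have : (j : ℚ) < (((M / 2 : ℕ) : ℤ) : ℚ) / 2 - 1 ↔ 2 * j + 2 < M / 2 := by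
    generalize M / 2 = k
    rw [lt_sub_iff_add_lt, lt_div_iff₀ two_pos, ← Nat.cast_lt (α := ℚ)]
    push_cast
    constructor <;> intro h <;> linarith
  simp only [Finset.mem_filter, Finset.mem_range, this]
  omega

/-- With `M = n - 69`, the sum `upperSum n` runs over `⌊M / 2⌋ ≤ 2 * j + 2 < M`. -/
theorem upperSum_add (M : ℕ) :
    upperSum (M + 69)
      = ∑ j ∈ Finset.range (M / 2), if M / 2 ≤ 2 * j + 2 ∧ 2 * j + 2 < M then 4 ^ j else 0 := by
  unfold upperSum
  rw [← Finset.sum_filter, halfIndex_add]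
  refine Finset.sum_congr ?_ fun j _ => by rw [pow_mul]; norm_num
  ext j
  have h1 : (j : ℚ) < (((M + 69 : ℕ) : ℚ) - 69) / 2 - 1 ↔ 2 * j + 2 < M := by
    rw [lt_sub_iff_add_lt, lt_div_iff₀ two_pos, ← Nat.cast_lt (α := ℚ)]
    push_cast
    constructor <;> intro h <;> linarith
  have h2 : ⌈(((M / 2 : ℕ) : ℤ) : ℚ) / 2⌉ - 1 ≤ (j : ℤ) ↔ M / 2 ≤ 2 * j + 2 := by
    generalize M / 2 = k
    rw [sub_le_iff_le_add, Int.ceil_le, div_le_iff₀ two_pos, ← Nat.cast_le (α := ℚ)]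
    push_cast
    constructor <;> intro h <;> linarith
  simp only [Finset.mem_filter, Finset.mem_range, h1, h2]
  omega

/-- The digit of `x * upperSum n + y * lowerSum n` at `4 ^ j`, with `M = n - 69`. -/
def insertionDigit (M : ℕ) (x y : ℤ) (j : ℕ) : ℤ :=
  if 2 * j + 2 < M / 2 then y else if 2 * j + 2 < M then x else 0

theorem upperSum_mul_add_lowerSum_mul (M : ℕ) (x y : ℤ) :
    x * upperSum (M + 69) + y * lowerSum (M + 69)
      = ∑ j ∈ Finset.range (M / 2), insertionDigit M x y j * 4 ^ j := by
  rw [upperSum_add, lowerSum_add, Finset.mul_sum, Finset.mul_sum, ← Finset.sum_add_distrib]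
  refine Finset.sum_congr rfl fun j _ => ?_
  unfold insertionDigit
  split_ifs <;> omega

/-- Each of the two inserted terms has about `M / 4` nonzero digits. -/
theorem le_sum_abs_insertionDigit (M : ℕ) {x y : ℤ} (h : x ≠ 0 ∨ y ≠ 0) :
    (M : ℤ) ≤ 4 * (∑ j ∈ Finset.range (M / 2), |insertionDigit M x y j|) + 8 := by
  have main : ∀ s ⊆ Finset.range (M / 2), (∀ j ∈ s, insertionDigit M x y j ≠ 0) →
      (M : ℤ) ≤ 4 * s.card + 8 →
      (M : ℤ) ≤ 4 * (∑ j ∈ Finset.range (M / 2), |insertionDigit M x y j|) + 8 := by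
    intro s hs hne hcard
    have h1 : (s.card : ℤ) ≤ ∑ j ∈ s, |insertionDigit M x y j| := by
      rw [Finset.cast_card]
      exact Finset.sum_le_sum fun j hj => Int.one_le_abs (hne j hj)
    have h2 := Finset.sum_le_sum_of_subset_of_nonneg hs
      (f := fun j => |insertionDigit M x y j|) fun j _ _ => abs_nonneg _
    linarith
  -- The positions `j < M / 4 - 1` belong to `lowerSum`, and those from `M / 4` to `M / 2 - 2`
  -- to `upperSum`.
  rcases h with h | h
  · refine main (Finset.Ico (M / 4) (M / 2 - 1)) (fun j hj => ?_) (fun j hj => ?_) ?_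
    · simp only [Finset.mem_Ico, Finset.mem_range] at *
      omega
    · rw [Finset.mem_Ico] at hj
      rw [insertionDigit, if_neg (by omega), if_pos (by omega)]
      exact h
    · rw [Nat.card_Ico]
      omega
  · refine main (Finset.range (M / 4 - 1)) (fun j hj => ?_) (fun j hj => ?_) ?_
    · simp only [Finset.mem_range] at *
      omega
    · rw [Finset.mem_range] at hj
      rw [insertionDigit, if_pos (by omega)]
      exact h
    · rw [Finset.card_range]
      omega

/-! ### Relations among the terms of the sequence -/

theorem sum_mul_twoInsertions (cbar : ℕ → ℤ) (M : ℕ) (d : ℕ → ℤ) :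
    ∑ i ∈ Finset.Icc 1 (M + 69), d i * twoInsertions cbar (M + 69) i
      = ∑ i ∈ Finset.range M, d (i + 1) * 2 ^ i
        + 2 ^ M * ∑ i ∈ Finset.Icc 1 67, d (M + i) * cbar i
        + (d (M + 69) * upperSum (M + 69) + d (M + 68) * lowerSum (M + 69)) := by
  have hlow : ∑ i ∈ Finset.range M, d (i + 1) * twoInsertions cbar (M + 69) (i + 1)
      = ∑ i ∈ Finset.range M, d (i + 1) * 2 ^ i := by
    refine Finset.sum_congr rfl fun i hi => ?_
    rw [Finset.mem_range] at hi
    rw [twoInsertions, if_neg (by omega), if_neg (by omega), lunnonSeq, if_pos (by omega),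
      Nat.add_sub_cancel]
  have hmid : ∑ i ∈ Finset.range 67, d (M + i + 1) * twoInsertions cbar (M + 69) (M + i + 1)
      = 2 ^ M * ∑ i ∈ Finset.Icc 1 67, d (M + i) * cbar i := by
    rw [sum_Icc_one_eq_sum_range, Finset.mul_sum]
    refine Finset.sum_congr rfl fun i hi => ?_
    rw [Finset.mem_range] at hi
    rw [twoInsertions, if_neg (by omega), if_neg (by omega), lunnonSeq, if_neg (by omega),
      show M + 69 - 2 - 67 = M by omega, show M + i + 1 - M = i + 1 by omega]
    ring_nf
  rw [sum_Icc_one_eq_sum_range, show M + 69 = M + 67 + 1 + 1 by ring, Finset.sum_range_succ,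
    Finset.sum_range_succ, Finset.sum_range_add, hlow, hmid]
  have h69 : twoInsertions cbar (M + 69) (M + 69) = upperSum (M + 69) := if_pos rfl
  have h68 : twoInsertions cbar (M + 69) (M + 68) = lowerSum (M + 69) := by
    rw [twoInsertions, if_neg (by omega), if_pos (by omega)]
  simp only [add_assoc, Nat.reduceAdd, h69, h68]
  ring

/-- A nontrivial relation with coefficients `-1, 0, 1` among the terms of the sequence has at
least `M / 4 - 2` nonzero coefficients, where `M = n - 69`. -/
theorem le_sum_abs_of_relation {cbar : ℕ → ℤ} (hcbar : IsSumDistinct 67 cbar) (M : ℕ) (d : ℕ → ℤ)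
    (hd : ∀ i, |d i| ≤ 1)
    (h : ∑ i ∈ Finset.Icc 1 (M + 69), d i * twoInsertions cbar (M + 69) i = 0)
    (hne : ∃ i ∈ Finset.Icc 1 (M + 69), d i ≠ 0) :
    (M : ℤ) ≤ 4 * (∑ i ∈ Finset.Icc 1 (M + 69), |d i|) + 8 := by
  rw [sum_mul_twoInsertions] at h
  by_cases hxy : d (M + 69) ≠ 0 ∨ d (M + 68) ≠ 0
  · refine (le_sum_abs_insertionDigit M hxy).trans ?_
    rw [upperSum_mul_add_lowerSum_mul] at h
    have hdvd : (4 : ℤ) ^ (M / 2) ∣ 2 ^ M := by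
      rw [show (4 : ℤ) = 2 ^ 2 by norm_num, ← pow_mul]
      exact pow_dvd_pow _ (Nat.mul_div_le M 2)
    -- For odd `M` the highest binary digit lies beyond the modulus `4 ^ (M / 2)`.
    have hsplit : (4 : ℤ) ^ (M / 2) ∣ ∑ i ∈ Finset.range M, d (i + 1) * 2 ^ i
        - ∑ i ∈ Finset.range (2 * (M / 2)), d (i + 1) * 2 ^ i := by
      rw [← Finset.sum_sdiff_eq_sub (Finset.range_subset_range.mpr (Nat.mul_div_le M 2))]
      refine Finset.dvd_sum fun i hi => ?_
      simp only [Finset.mem_sdiff, Finset.mem_range, not_lt] at hi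
      rw [show (4 : ℤ) = 2 ^ 2 by norm_num, ← pow_mul]
      exact (pow_dvd_pow _ hi.2).mul_left _
    have key := sum_abs_le_of_four_pow_dvd (M / 2) (fun i => -d (i + 1))
      (insertionDigit M (d (M + 69)) (d (M + 68))) 0 (fun i => by rw [abs_neg]; exact hd _)
      (fun j => by unfold insertionDigit; split_ifs <;> simp [hd]) (by simp) (by
        obtain ⟨q, hq⟩ := hdvd
        obtain ⟨r, hr⟩ := hsplit
        refine ⟨r + q * ∑ i ∈ Finset.Icc 1 67, d (M + i) * cbar i, ?_⟩
        simp only [neg_mul, Finset.sum_neg_distrib]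
        rw [hq] at h
        linarith)
    have hle : ∑ i ∈ Finset.range (2 * (M / 2)), |d (i + 1)|
        ≤ ∑ i ∈ Finset.Icc 1 (M + 69), |d i| := by
      rw [sum_Icc_one_eq_sum_range]
      exact Finset.sum_le_sum_of_subset_of_nonneg (Finset.range_subset_range.mpr (by omega))
        fun i _ _ => abs_nonneg _
    simp only [abs_neg, abs_zero, zero_add] at key
    linarith
  · exfalso
    push Not at hxy
    rw [hxy.1, hxy.2, zero_mul, zero_mul, add_zero, add_zero] at h
    have hlow := eq_zero_of_two_pow_dvd M (fun i => d (i + 1)) (fun i => hd _)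
      ⟨-∑ i ∈ Finset.Icc 1 67, d (M + i) * cbar i, by linarith⟩
    have hmid := hcbar.eq_zero (fun i => d (M + i)) (fun i => hd _) (by
      rw [Finset.sum_eq_zero (fun i hi => by
        rw [hlow i (Finset.mem_range.mp hi), zero_mul]), zero_add] at h
      exact (mul_eq_zero.mp h).resolve_left (by positivity))
    obtain ⟨i, hi, hdi⟩ := hne
    rw [Finset.mem_Icc] at hi
    apply hdi
    rcases le_or_gt i M with hiM | hiM
    · have := hlow (i - 1) (by omega)
      rwa [Nat.sub_add_cancel hi.1] at this
    · rcases le_or_gt i (M + 67) with hi' | hi'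
      · have := hmid (i - M) (Finset.mem_Icc.mpr (by omega))
        rwa [Nat.add_sub_cancel' hiM.le] at this
      · obtain rfl | rfl : i = M + 69 ∨ i = M + 68 := by omega
        exacts [hxy.1, hxy.2]

end SumDistinct

theorem mainTheorem6 (lam : ℝ) (hlam : lam < 1 / 8) :
    ∃ N : ℕ, 69 ≤ N ∧ ∀ n : ℕ, N ≤ n →
      ∀ cbar : ℕ → ℤ, SumDistinct.IsSumDistinct 67 cbar →
        SumDistinct.IsSumDistinctUpTo lam n (SumDistinct.twoInsertions cbar n) := by
  -- `n - 69 ≤ 4 * (2 * lam * n) + 8` fails as soon as `(1 - 8 * lam) * n > 77`.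
  obtain ⟨N, hN⟩ := exists_nat_gt (77 / (1 - 8 * lam))
  refine ⟨max N 69, le_max_right _ _, fun n hn cbar hcbar A hA B hB hAB hsum => ?_⟩
  obtain ⟨M, rfl⟩ := Nat.exists_eq_add_of_le' ((le_max_right _ _).trans hn)
  have hNn : (N : ℝ) ≤ ((M + 69 : ℕ) : ℝ) := Nat.cast_le.mpr ((le_max_left _ _).trans hn)
  obtain ⟨hA, hAcard⟩ := hA
  obtain ⟨hB, hBcard⟩ := hB
  have hrel := SumDistinct.le_sum_abs_of_relation hcbar M (SumDistinct.signDiff A B)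
    (SumDistinct.abs_signDiff_le_one A B)
    (by rw [SumDistinct.sum_signDiff_mul hA hB, hsum, sub_self])
    (by
      by_contra! h
      exact hAB (SumDistinct.eq_of_signDiff_eq_zero hA hB h))
  have hcard : (M : ℤ) ≤ 4 * (A.card + B.card) + 8 := by
    have := SumDistinct.sum_abs_signDiff_le hA hB
    linarith
  have hcard' : (M : ℝ) ≤ 4 * (A.card + B.card) + 8 := by exact_mod_cast hcard
  have hpos : 0 < 1 - 8 * lam := by linarith
  rw [div_lt_iff₀ hpos] at hN
  have := mul_le_mul_of_nonneg_right hNn hpos.le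
  push_cast at this hAcard hBcard
  linarith
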